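/- Let $\ell^2(\mathbb Z_{\ge 0})$ be the complex Hilbert space of square-summable sequences $\lambda=(\lambda_n)_{n\ge 0}$, and let $A$ be the discrete radial Laplacian (without boundary conditions) $$(A\lambda)_n = -(n+1)(\lambda_{n+1}-\lambda_n) + n(\lambda_n-\lambda_{n-1}),\qquad n\ge 0,$$ (for $n=0$ the second term is absent), with its maximal domain $\{\lambda\in\ell^2(\mathbb Z_{\ge 0}) : A\lambda\in\ell^2(\mathbb Z_{\ge 0})\}$. Then $A$ is self-adjoint, its spectrum is equal to $[0,\infty)$, and its spectrum is purely absolutely continuous; that is, if $E$ denotes the projection-valued spectral measure of $A$, so that $A=\int_{\mathbb R} t\,dE(t)$, then for every $\lambda\in\ell^2(\mathbb Z_{\ge 0})$ the finite Borel measure $B\mapsto\langle\lambda,E(B)\lambda\rangle$ on $\mathbb R$ is absolutely continuous with respect to Lebesgue measure. -/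

import Mathlib

open scoped InnerProductSpace

noncomputable section

/-! ### Unbounded operators: resolvent set, spectrum, spectral measure -/

namespace UnboundedOperator

variable {H : Type*} [NormedAddCommGroup H] [InnerProductSpace ℂ H]

/-- The resolvent set of a (not necessarily bounded) operator `A` on `H`: the complex numbers `z`
for which `A - z : dom A → H` is a bijection with a bounded inverse `R`. -/
def resolventSet (A : H →ₗ.[ℂ] H) : Set ℂ :=
  {z | ∃ R : H →L[ℂ] H,
    (∀ y : H, ∃ h : R y ∈ A.domain, A ⟨R y, h⟩ - z • R y = y) ∧
    (∀ x : A.domain, R (A x - z • (x : H)) = x)}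

/-- The spectrum: the complement of the resolvent set. -/
def spectrum (A : H →ₗ.[ℂ] H) : Set ℂ := (resolventSet A)ᶜ

variable (H) in
/-- A projection-valued measure on the Borel sets of `ℝ`: orthogonal projections `E B` with
`E ℝ = 1`, countably additive in the strong operator topology. The values of `E` on non-Borel
sets play no role. -/
structure ProjectionValuedMeasure [CompleteSpace H] where
  proj : Set ℝ → H →L[ℂ] H
  isStarProjection : ∀ B, MeasurableSet B → IsStarProjection (proj B)
  proj_univ : proj Set.univ = 1
  hasSum_iUnion : ∀ B : ℕ → Set ℝ, (∀ i, MeasurableSet (B i)) →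
    Pairwise (fun i j => Disjoint (B i) (B j)) →
    ∀ x, HasSum (fun i => proj (B i) x) (proj (⋃ i, B i) x)

namespace ProjectionValuedMeasure

variable [CompleteSpace H] (E : ProjectionValuedMeasure H)

theorem proj_empty (x : H) : E.proj ∅ x = 0 := by
  have h := E.hasSum_iUnion (fun _ => ∅) (fun _ => MeasurableSet.empty)
    (fun _ _ _ => disjoint_bot_left) x
  exact (summable_const_iff _).1 h.summable

theorem inner_proj {B : Set ℝ} (hB : MeasurableSet B) (x : H) :
    ⟪x, E.proj B x⟫_ℂ = ((‖E.proj B x‖ ^ 2 : ℝ) : ℂ) := by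
  have hP := E.isStarProjection B hB
  have h1 : E.proj B (E.proj B x) = E.proj B x := by
    have := congrArg (fun T : H →L[ℂ] H => T x) hP.isIdempotentElem.eq
    simpa using this
  have h2 := (ContinuousLinearMap.isSelfAdjoint_iff_isSymmetric.1 hP.isSelfAdjoint) x (E.proj B x)
  simp only [ContinuousLinearMap.coe_coe] at h2
  rw [h1] at h2
  rw [← h2, inner_self_eq_norm_sq_to_K]
  norm_cast

/-- The scalar spectral measure `μ_x(B) = ⟪x, E(B) x⟫ = ‖E(B) x‖²` of a vector `x`. -/
def scalarMeasure (x : H) : MeasureTheory.Measure ℝ :=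
  MeasureTheory.Measure.ofMeasurable (fun B _ => ENNReal.ofReal (‖E.proj B x‖ ^ 2))
    (by simp [proj_empty])
    (by
      intro B hB hd
      have h := (E.hasSum_iUnion B hB hd x).mapL (innerSL ℂ x)
      simp only [innerSL_apply_apply, E.inner_proj (hB _),
        E.inner_proj (MeasurableSet.iUnion hB)] at h
      have h' := Complex.hasSum_ofReal.1 h
      rw [← h'.tsum_eq, ENNReal.ofReal_tsum_of_nonneg (fun _ => by positivity) h'.summable])

theorem scalarMeasure_apply (x : H) {B : Set ℝ} (hB : MeasurableSet B) :
    E.scalarMeasure x B = ENNReal.ofReal (‖E.proj B x‖ ^ 2) :=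
  MeasureTheory.Measure.ofMeasurable_apply B hB

/-- `E` is the spectral measure of `A`, that is `A = ∫ t dE(t)`: the domain of `A` consists of
the vectors `x` with `∫ t² dμ_x(t) < ∞`, and `⟪x, A x⟫ = ∫ t dμ_x(t)` on the domain. (Here `t` is
integrable for the finite measure `μ_x`; by polarization the second clause determines `A`.) -/
def IsSpectralMeasureOf (A : H →ₗ.[ℂ] H) : Prop :=
  (∀ x : H, x ∈ A.domain ↔ ∫⁻ t, ENNReal.ofReal (t ^ 2) ∂(E.scalarMeasure x) < ⊤) ∧
  (∀ x : A.domain, ⟪(x : H), A x⟫_ℂ = ((∫ t, t ∂(E.scalarMeasure (x : H)) : ℝ) : ℂ))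

end ProjectionValuedMeasure

/-- `A` has purely absolutely continuous spectrum: `A` has a spectral measure `E`, and the scalar
spectral measure `⟪x, E(·) x⟫` of every vector `x` is absolutely continuous with respect to
Lebesgue measure. -/
def HasPurelyAbsolutelyContinuousSpectrum [CompleteSpace H] (A : H →ₗ.[ℂ] H) : Prop :=
  ∃ E : ProjectionValuedMeasure H, E.IsSpectralMeasureOf A ∧
    ∀ x : H, (E.scalarMeasure x).AbsolutelyContinuous MeasureTheory.volume

end UnboundedOperator

/-! ### The discrete radial Laplacian -/

/-- The complex Hilbert space of square-summable sequences indexed by `n = 0, 1, 2, …`. -/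
abbrev SquareSummable : Type := lp (fun _ : ℕ => ℂ) 2

/-- The difference expression `(A u)_n = -(n+1) (u_{n+1} - u_n) + n (u_n - u_{n-1})` on all
complex sequences. For `n = 0` the last term vanishes, whatever `u (0 - 1)` is taken to be. -/
def radialLaplacianExpr : (ℕ → ℂ) →ₗ[ℂ] (ℕ → ℂ) where
  toFun u n := -((n : ℂ) + 1) * (u (n + 1) - u n) + (n : ℂ) * (u n - u (n - 1))
  map_add' u v := by
    funext n
    simp only [Pi.add_apply]
    ring
  map_smul' c u := by
    funext n
    simp only [Pi.smul_apply, smul_eq_mul, RingHom.id_apply]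
    ring

/-- The discrete radial Laplacian on `ℓ²(ℤ_{≥0})`, without boundary conditions: the difference
expression on its maximal domain `{u ∈ ℓ² : A u ∈ ℓ²}`. -/
def radialLaplacian : SquareSummable →ₗ.[ℂ] SquareSummable where
  domain :=
    { carrier := {u | Memℓp (radialLaplacianExpr (fun n => u n)) 2}
      zero_mem' := by
        have h : radialLaplacianExpr (fun n => (0 : SquareSummable) n) = 0 :=
          radialLaplacianExpr.map_zero
        change Memℓp (radialLaplacianExpr (fun n => (0 : SquareSummable) n)) 2
        rw [h]
        exact zero_memℓp
      add_mem' := by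
        intro u v hu hv
        have h : radialLaplacianExpr (fun n => (u + v) n)
            = radialLaplacianExpr (fun n => u n) + radialLaplacianExpr (fun n => v n) :=
          radialLaplacianExpr.map_add (fun n => u n) (fun n => v n)
        change Memℓp (radialLaplacianExpr (fun n => (u + v) n)) 2
        rw [h]
        exact Memℓp.add hu hv
      smul_mem' := by
        intro c u hu
        have h : radialLaplacianExpr (fun n => (c • u) n)
            = c • radialLaplacianExpr (fun n => u n) :=
          radialLaplacianExpr.map_smul c (fun n => u n)
        change Memℓp (radialLaplacianExpr (fun n => (c • u) n)) 2
        rw [h]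
        exact Memℓp.const_smul hu c }
  toFun :=
    { toFun := fun u => ⟨radialLaplacianExpr (fun n => (u : SquareSummable) n), u.2⟩
      map_add' := fun u v => Subtype.ext
        (radialLaplacianExpr.map_add (fun n => (u : SquareSummable) n)
          (fun n => (v : SquareSummable) n))
      map_smul' := fun c u => Subtype.ext
        (radialLaplacianExpr.map_smul c (fun n => (u : SquareSummable) n)) }

theorem mem_radialLaplacian_domain_iff (u : SquareSummable) :
    u ∈ radialLaplacian.domain ↔
      Memℓp (fun n : ℕ => -((n : ℂ) + 1) * (u (n + 1) - u n) + (n : ℂ) * (u n - u (n - 1))) 2 :=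
  Iff.rfl

theorem radialLaplacian_apply (u : radialLaplacian.domain) (n : ℕ) :
    (radialLaplacian u : SquareSummable) n =
      -((n : ℂ) + 1) * ((u : SquareSummable) (n + 1) - (u : SquareSummable) n) +
        (n : ℂ) * ((u : SquareSummable) n - (u : SquareSummable) (n - 1)) :=
  rfl

end

open MeasureTheory ProbabilityTheory Filter Topology
open scoped InnerProductSpace ENNReal

/-! The recurrence `t L_n = (2n+1) L_n - (n+1) L_{n+1} - n L_{n-1}` of the Laguerre polynomials has
exactly the coefficients of the radial Laplacian. Since the `L_n` form an orthonormal basis of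
`L²(e^{-t} dt)` on the half-line, `λ ↦ ∑ λ_n L_n` is a unitary map that carries the operator to
multiplication by `t` (`isMultiplicationModel_radialLaplacian`). Self-adjointness, spectrum and
spectral measure are then read off from the multiplication operator: the spectral measure of `x` is
`|Ux|² e^{-t} dt`.

Two points need analysis: completeness of the `L_n`, and the fact that the maximal domain
corresponds to all `f` with `t f ∈ L²`. Both follow from the determinacy of moments under an
exponential weight (`ae_eq_zero_of_moments_eq_zero`), used in the form
`ae_eq_zero_of_integral_laguerre_mul_eq_zero`. -/

theorem integral_mul_sub_mul_sub_mul {α 𝕜 : Type*} [RCLike 𝕜] {mα : MeasurableSpace α}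
    {μ : Measure α} {f g h : α → 𝕜} (hf : Integrable f μ) (hg : Integrable g μ)
    (hh : Integrable h μ) (a b c : 𝕜) :
    ∫ t, a * f t - b * g t - c * h t ∂μ =
      a * ∫ t, f t ∂μ - b * ∫ t, g t ∂μ - c * ∫ t, h t ∂μ := by
  have hf' := hf.const_mul a
  have hg' := hg.const_mul b
  rw [← integral_const_mul, ← integral_const_mul, ← integral_const_mul, ← integral_sub hf' hg']
  exact integral_sub (hf'.sub hg') (hh.const_mul c)

/-! ### Moment determinacy under an exponential weight -/

/-- A finite measure on the line with an exponential moment is determined by its moments. -/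
theorem measure_ext_of_moments {μ ν : Measure ℝ} [IsFiniteMeasure μ] [IsFiniteMeasure ν]
    (hμ : (0 : ℝ) ∈ interior (integrableExpSet id μ))
    (hν : (0 : ℝ) ∈ interior (integrableExpSet id ν))
    (h : ∀ n : ℕ, ∫ t, t ^ n ∂μ = ∫ t, t ^ n ∂ν) : μ = ν := by
  -- On this vertical strip around the imaginary axis both complex moment generating functions are
  -- analytic. Their Taylor coefficients at `0` are the moments up to factorials, so they agree on
  -- the strip; on the imaginary axis they are the characteristic functions.
  set S : Set ℂ := {z | z.re ∈ interior (integrableExpSet id μ)} ∩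
    {z | z.re ∈ interior (integrableExpSet id ν)} with hS
  have hconv : Convex ℝ S :=
    ((convex_integrableExpSet.interior).linear_preimage Complex.reLm).inter
      ((convex_integrableExpSet.interior).linear_preimage Complex.reLm)
  have h0 : (0 : ℂ) ∈ S := ⟨by simpa using hμ, by simpa using hν⟩
  have aμ : AnalyticOnNhd ℂ (complexMGF id μ) S := fun z hz => analyticAt_complexMGF hz.1
  have aν : AnalyticOnNhd ℂ (complexMGF id ν) S := fun z hz => analyticAt_complexMGF hz.2
  have hev : complexMGF id μ =ᶠ[𝓝 0] complexMGF id ν := by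
    have e1 := (aμ 0 h0).hasFPowerSeriesAt
    have e2 := (aν 0 h0).hasFPowerSeriesAt
    have : (fun n => iteratedDeriv n (complexMGF id μ) 0 / (n.factorial : ℂ)) =
        fun n => iteratedDeriv n (complexMGF id ν) 0 / (n.factorial : ℂ) := by
      funext n
      rw [iteratedDeriv_complexMGF h0.1, iteratedDeriv_complexMGF h0.2]
      congr 1
      have := congrArg (fun r : ℝ => (r : ℂ)) (h n)
      simp only [← integral_complex_ofReal] at this
      simpa using this
    rw [this] at e1
    have e := e1.sub e2
    rw [sub_self] at e
    exact e.eventually_eq_zero.mono fun z hz => sub_eq_zero.1 hz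
  have heq := aμ.eqOn_of_preconnected_of_eventuallyEq aν hconv.isPreconnected h0 hev
  refine Measure.ext_of_charFun (funext fun t => ?_)
  rw [← complexMGF_id_mul_I, ← complexMGF_id_mul_I]
  exact heq ⟨by simpa using hμ, by simpa using hν⟩

theorem zero_mem_interior_integrableExpSet {μ : Measure ℝ} {c : ℝ} (hc : 0 < c)
    (h : Integrable (fun t => Real.exp (c * |t|)) μ) :
    (0 : ℝ) ∈ interior (integrableExpSet id μ) := by
  rw [mem_interior_iff_mem_nhds]
  filter_upwards [Ioo_mem_nhds (neg_lt_zero.2 hc) hc] with s hs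
  refine h.mono' (by fun_prop) (.of_forall fun t => ?_)
  rw [Real.norm_eq_abs, Real.abs_exp]
  refine Real.exp_le_exp.2 ((le_abs_self _).trans ?_)
  rw [id, abs_mul]
  gcongr
  exact abs_le.2 ⟨hs.1.le, hs.2.le⟩

theorem integrable_pow_mul_of_integrable_exp_mul {𝕜 : Type*} [RCLike 𝕜] {μ : Measure ℝ} {c : ℝ}
    (hc : 0 < c) {f : ℝ → 𝕜} (hf : AEStronglyMeasurable f μ)
    (hint : Integrable (fun t => (Real.exp (c * |t|) : 𝕜) * f t) μ) (n : ℕ) :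
    Integrable (fun t : ℝ => (t : 𝕜) ^ n * f t) μ := by
  refine (hint.norm.const_mul (n.factorial / c ^ n)).mono' (by fun_prop) (.of_forall fun t => ?_)
  have h1 := Real.pow_div_factorial_le_exp (c * |t|) (by positivity) n
  rw [norm_mul, norm_mul, norm_pow, RCLike.norm_ofReal, RCLike.norm_ofReal, Real.abs_exp,
    ← mul_assoc]
  gcongr
  rw [div_mul_eq_mul_div, le_div_iff₀ (by positivity)]
  rw [div_le_iff₀ (by positivity), mul_pow] at h1
  linarith

/-- The positive and negative parts of `f` are densities of two finite measures with exponential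
moments. Vanishing moments of `f` make all their moments equal, so the measures coincide and `f⁺ =
f⁻` almost everywhere. -/
theorem ae_eq_zero_of_moments_eq_zero_real {μ : Measure ℝ} [SFinite μ] {c : ℝ} (hc : 0 < c)
    {f : ℝ → ℝ} (hf : AEStronglyMeasurable f μ)
    (hint : Integrable (fun t => Real.exp (c * |t|) * f t) μ)
    (hmom : ∀ n : ℕ, ∫ t, t ^ n * f t ∂μ = 0) : f =ᵐ[μ] 0 := by
  wlog hm : StronglyMeasurable f generalizing f
  · have e := hf.ae_eq_mk
    refine e.trans (this hf.stronglyMeasurable_mk.aestronglyMeasurable ?_ ?_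
      hf.stronglyMeasurable_mk)
    · exact hint.congr (e.mono fun t ht => by simp only [ht])
    · intro n
      rw [← hmom n]
      exact integral_congr_ae (e.mono fun t ht => by simp only [ht])
  have hfm : Measurable f := hm.measurable
  have hpow : ∀ n : ℕ, Integrable (fun t => t ^ n * f t) μ :=
    integrable_pow_mul_of_integrable_exp_mul hc hf hint
  have hf1 : Integrable f μ := by simpa using hpow 0
  have key : ∀ g : ℝ → ℝ, Measurable g → (∀ t, |g t| ≤ |f t|) →
      (∀ t, 0 ≤ g t) → IsFiniteMeasure (μ.withDensity fun t => ENNReal.ofReal (g t)) ∧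
        (0 : ℝ) ∈ interior (integrableExpSet id (μ.withDensity fun t => ENNReal.ofReal (g t))) ∧
        ∀ n : ℕ, ∫ t, t ^ n ∂(μ.withDensity fun t => ENNReal.ofReal (g t)) =
          ∫ t, t ^ n * g t ∂μ := by
    intro g hg hgf hg0
    refine ⟨isFiniteMeasure_withDensity_ofReal (hf1.mono hg.aestronglyMeasurable
      (.of_forall hgf)).2, zero_mem_interior_integrableExpSet hc ?_, fun n => ?_⟩
    · rw [integrable_withDensity_iff (by fun_prop) (.of_forall fun t => by simp)]
      refine hint.mono (by fun_prop) (.of_forall fun t => ?_)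
      rw [norm_mul, norm_mul, ENNReal.toReal_ofReal (hg0 t)]
      exact mul_le_mul_of_nonneg_left (hgf t) (norm_nonneg _)
    · rw [integral_withDensity_eq_integral_toReal_smul (by fun_prop) (.of_forall fun t => by simp)]
      refine integral_congr_ae (.of_forall fun t => ?_)
      simp [ENNReal.toReal_ofReal (hg0 t), mul_comm]
  have hp : ∀ t, |max (f t) 0| ≤ |f t| := fun t => by
    rw [abs_of_nonneg (le_max_right _ _)]; exact max_le (le_abs_self _) (abs_nonneg _)
  have hn : ∀ t, |max (-f t) 0| ≤ |f t| := fun t => by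
    rw [abs_of_nonneg (le_max_right _ _)]; exact max_le (neg_le_abs _) (abs_nonneg _)
  obtain ⟨f1, i1, m1⟩ := key (fun t => max (f t) 0) (by fun_prop) hp fun t => le_max_right _ _
  obtain ⟨f2, i2, m2⟩ := key (fun t => max (-f t) 0) (by fun_prop) hn fun t => le_max_right _ _
  have heq := measure_ext_of_moments i1 i2 fun n => by
    rw [m1, m2, ← sub_eq_zero, ← integral_sub]
    · refine Eq.trans ?_ (hmom n)
      refine integral_congr_ae (.of_forall fun t => ?_)
      simp only [← mul_sub]
      congr 1
      rcases le_total (f t) 0 with h | h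
      · rw [max_eq_right h, max_eq_left (by linarith)]; ring
      · rw [max_eq_left h, max_eq_right (by linarith)]; ring
    · refine (hpow n).mono (by fun_prop) (.of_forall fun t => ?_)
      rw [norm_mul, norm_mul]; exact mul_le_mul_of_nonneg_left (hp t) (norm_nonneg _)
    · refine (hpow n).mono (by fun_prop) (.of_forall fun t => ?_)
      rw [norm_mul, norm_mul]; exact mul_le_mul_of_nonneg_left (hn t) (norm_nonneg _)
  have hae := (withDensity_eq_iff (by fun_prop) (by fun_prop) (by
    have := f1.measure_univ_lt_top
    rw [withDensity_apply _ MeasurableSet.univ, Measure.restrict_univ] at this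
    exact this.ne)).1 heq
  filter_upwards [hae] with t ht
  have ht' := (ENNReal.ofReal_eq_ofReal_iff (le_max_right _ _) (le_max_right _ _)).1 ht
  rcases le_total (f t) 0 with h | h
  · rw [max_eq_right h, max_eq_left (by linarith)] at ht'; simpa using ht'.symm
  · rw [max_eq_left h, max_eq_right (by linarith)] at ht'; simpa using ht'

/-- A function with an exponential weight and vanishing moments vanishes almost everywhere. -/
theorem ae_eq_zero_of_moments_eq_zero {μ : Measure ℝ} [SFinite μ] {c : ℝ} (hc : 0 < c)
    {f : ℝ → ℂ} (hf : AEStronglyMeasurable f μ)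
    (hint : Integrable (fun t => (Real.exp (c * |t|) : ℂ) * f t) μ)
    (hmom : ∀ n : ℕ, ∫ t, (t : ℂ) ^ n * f t ∂μ = 0) : f =ᵐ[μ] 0 := by
  have hpow : ∀ n : ℕ, Integrable (fun t : ℝ => (t : ℂ) ^ n * f t) μ :=
    integrable_pow_mul_of_integrable_exp_mul hc hf hint
  have hre := ae_eq_zero_of_moments_eq_zero_real hc (f := fun t => (f t).re)
    hf.re (by simpa only [RCLike.re_to_complex, Complex.re_ofReal_mul] using hint.re) fun n => by
      have := congrArg Complex.re (hmom n)
      rw [← RCLike.re_to_complex, ← integral_re (hpow n)] at this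
      simpa only [RCLike.re_to_complex, ← Complex.ofReal_pow, Complex.re_ofReal_mul, Complex.zero_re] using this
  have him := ae_eq_zero_of_moments_eq_zero_real hc (f := fun t => (f t).im)
    hf.im (by simpa only [RCLike.im_to_complex, Complex.im_ofReal_mul] using hint.im) fun n => by
      have := congrArg Complex.im (hmom n)
      rw [← RCLike.im_to_complex, ← integral_im (hpow n)] at this
      simpa only [RCLike.im_to_complex, ← Complex.ofReal_pow, Complex.im_ofReal_mul, Complex.zero_im] using this
  filter_upwards [hre, him] with t h1 h2
  exact Complex.ext h1 h2

/-! ### Laguerre polynomials and their recurrence -/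

open Polynomial in
/-- The Laguerre polynomials `L_n = ∑ₖ (-1)ᵏ (n choose k) Xᵏ / k!`. -/
noncomputable def laguerre (n : ℕ) : ℝ[X] :=
  ∑ k ∈ Finset.range (n + 1), monomial k ((-1) ^ k * (n.choose k : ℝ) / (k.factorial : ℝ))

theorem laguerre_coeff (n k : ℕ) :
    (laguerre n).coeff k = (-1) ^ k * (n.choose k : ℝ) / (k.factorial : ℝ) := by
  simp only [laguerre, Polynomial.finsetSum_coeff, Polynomial.coeff_monomial, Finset.sum_ite_eq',
    Finset.mem_range]
  split_ifs with h
  · rfl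
  · rw [Nat.choose_eq_zero_of_lt (by omega)]; simp

theorem laguerre_zero : laguerre 0 = 1 := by
  simp [laguerre]

open Polynomial in
/-- The three-term recurrence. -/
theorem X_mul_laguerre (n : ℕ) :
    X * laguerre n = (2 * n + 1 : ℝ) • laguerre n - (n + 1 : ℝ) • laguerre (n + 1) -
      (n : ℝ) • laguerre (n - 1) := by
  ext k
  simp only [coeff_sub, coeff_smul, smul_eq_mul, laguerre_coeff]
  rcases k with _ | k
  · simp only [coeff_X_mul_zero, pow_zero, Nat.choose_zero_right, Nat.factorial_zero]
    push_cast
    ring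
  rw [coeff_X_mul, laguerre_coeff]
  have h1 : ((n + 1).choose (k + 1) : ℝ) = n.choose k + n.choose (k + 1) := by
    exact_mod_cast Nat.choose_succ_succ n k
  -- Pascal's rule and absorption; at `n = 0` the factor `n` hides the truncated `n - 1`.
  have h2 : (n : ℝ) * (n.choose (k + 1) - (n - 1).choose (k + 1)) = (k + 1) * n.choose (k + 1) := by
    rcases n with _ | n
    · simp
    · have a : ((n + 1).choose (k + 1) : ℝ) = n.choose k + n.choose (k + 1) := by
        exact_mod_cast Nat.choose_succ_succ n k
      have b : ((n + 1 : ℕ) : ℝ) * n.choose k = (n + 1).choose (k + 1) * (k + 1) := by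
        exact_mod_cast Nat.add_one_mul_choose_eq n k
      simp only [Nat.add_sub_cancel]
      rw [mul_comm (k + 1 : ℝ), ← b, a]
      ring
  have h3 : (n.choose (k + 1) : ℝ) * (k + 1) = n.choose k * (n - k) := by
    rcases le_or_gt k n with h | h
    · have := Nat.choose_succ_right_eq n k
      rw [← Nat.cast_sub h]
      exact_mod_cast this
    · rw [Nat.choose_eq_zero_of_lt h, Nat.choose_eq_zero_of_lt (by omega)]; simp
  have hk : (k.factorial : ℝ) ≠ 0 := by positivity
  rw [h1, Nat.factorial_succ, pow_succ]
  push_cast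
  field_simp
  linear_combination h2 + h3

/-! ### The weight `e^{-t}` and orthonormality -/

/-- The measure `e^{-t} dt` on the half-line `(0, ∞)`. -/
noncomputable def laguerreMeasure : Measure ℝ :=
  (volume.restrict (Set.Ioi 0)).withDensity fun t => ENNReal.ofReal (Real.exp (-t))

theorem laguerreMeasure_absolutelyContinuous : laguerreMeasure ≪ volume :=
  (withDensity_absolutelyContinuous _ _).trans Measure.absolutelyContinuous_restrict

theorem ae_laguerreMeasure_pos : ∀ᵐ t ∂laguerreMeasure, 0 < t :=
  (withDensity_absolutelyContinuous _ _).ae_le (ae_restrict_mem measurableSet_Ioi)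

theorem laguerreMeasure_pos {s : Set ℝ} (hs : MeasurableSet s) (h : s ⊆ Set.Ioi 0)
    (hv : volume s ≠ 0) : laguerreMeasure s ≠ 0 := by
  rw [laguerreMeasure, withDensity_apply _ hs, Measure.restrict_restrict hs,
    Set.inter_eq_left.2 h]
  rw [ne_eq, lintegral_eq_zero_iff (by fun_prop)]
  intro h0
  have : ∀ᵐ t ∂volume.restrict s, False := by
    filter_upwards [h0] with t ht
    have := ENNReal.ofReal_eq_zero.1 ht
    exact absurd this (not_le.2 (Real.exp_pos _))
  rw [eventually_false_iff_eq_bot, ae_eq_bot, Measure.restrict_eq_zero] at this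
  exact hv this

theorem integral_laguerreMeasure {E : Type*} [NormedAddCommGroup E] [NormedSpace ℝ E] (f : ℝ → E) :
    ∫ t, f t ∂laguerreMeasure = ∫ t in Set.Ioi 0, Real.exp (-t) • f t := by
  rw [laguerreMeasure, integral_withDensity_eq_integral_toReal_smul (by fun_prop)
    (.of_forall fun t => by simp)]
  simp [ENNReal.toReal_ofReal, Real.exp_nonneg]

theorem integrable_pow_mul_exp_laguerreMeasure (k : ℕ) {c : ℝ} (hc : c < 1) :
    Integrable (fun t : ℝ => t ^ k * Real.exp (c * t)) laguerreMeasure := by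
  rw [laguerreMeasure, integrable_withDensity_iff (by fun_prop) (.of_forall fun t => by simp)]
  have h := integrableOn_rpow_mul_exp_neg_mul_rpow (s := k) (p := 1) (b := 1 - c)
    (by have : (0 : ℝ) ≤ k := by positivity
        linarith) one_pos (by linarith)
  refine h.congr_fun (fun t ht => ?_) measurableSet_Ioi
  simp only [Real.rpow_one, Real.rpow_natCast]
  rw [ENNReal.toReal_ofReal (Real.exp_nonneg _), mul_assoc, ← Real.exp_add]
  ring_nf

instance : IsFiniteMeasure laguerreMeasure := by
  have h := integrable_pow_mul_exp_laguerreMeasure 0 (c := 0) one_pos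
  simpa [integrable_const_iff, isFiniteMeasure_iff, lt_top_iff_ne_top] using h

theorem integral_pow_laguerreMeasure (k : ℕ) : ∫ t, t ^ k ∂laguerreMeasure = k.factorial := by
  rw [integral_laguerreMeasure, ← Real.Gamma_nat_eq_factorial, Real.Gamma_eq_integral (by positivity)]
  refine setIntegral_congr_fun measurableSet_Ioi fun t ht => ?_
  simp

theorem integrable_eval_laguerreMeasure (p : Polynomial ℝ) :
    Integrable (fun t => p.eval t) laguerreMeasure := by
  induction p using Polynomial.induction_on' with
  | add p q hp hq => simpa only [Polynomial.eval_add] using! hp.add hq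
  | monomial n a =>
    simpa using (integrable_pow_mul_exp_laguerreMeasure n (c := 0) one_pos).const_mul a

theorem integral_laguerre (n : ℕ) :
    ∫ t, (laguerre n).eval t ∂laguerreMeasure = if n = 0 then 1 else 0 := by
  simp only [laguerre, Polynomial.eval_finsetSum, Polynomial.eval_monomial]
  rw [integral_finsetSum _ fun k _ => by
    simpa using integrable_eval_laguerreMeasure (Polynomial.monomial k
      ((-1) ^ k * (n.choose k : ℝ) / (k.factorial : ℝ)))]
  simp only [integral_const_mul, integral_pow_laguerreMeasure]
  -- The moment `k!` cancels the denominator of the `k`-th coefficient, leaving the alternating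
  -- binomial sum `(1 - 1)^n`.
  have := congrArg (fun z : ℤ => (z : ℝ)) (Int.alternating_sum_range_choose (n := n))
  push_cast at this
  rw [← this]
  refine Finset.sum_congr rfl fun k _ => ?_
  field_simp

/-- Multiplication by `t` is symmetric, so expanding `∫ t L_n L_m` by the recurrence in `n` and in
`m` gives the same value. This expresses row `n + 1` of the Gram matrix through rows `n` and `n -
1`, and row `0` is `integral_laguerre`. -/
theorem integral_laguerre_mul_laguerre (n m : ℕ) :
    ∫ t, (laguerre n).eval t * (laguerre m).eval t ∂laguerreMeasure = if n = m then 1 else 0 := by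
  set B : ℕ → ℕ → ℝ := fun n m =>
    ∫ t, (laguerre n).eval t * (laguerre m).eval t ∂laguerreMeasure with hB
  have hi : ∀ n m, Integrable (fun t => (laguerre n).eval t * (laguerre m).eval t)
      laguerreMeasure := fun n m => by
    simpa using integrable_eval_laguerreMeasure (laguerre n * laguerre m)
  have hX : ∀ n (t : ℝ), t * (laguerre n).eval t = (2 * n + 1) * (laguerre n).eval t -
      (n + 1) * (laguerre (n + 1)).eval t - n * (laguerre (n - 1)).eval t := fun n t => by
    simpa using congrArg (Polynomial.eval t) (X_mul_laguerre n)
  have hl : ∀ n m, ∫ t, t * ((laguerre n).eval t * (laguerre m).eval t) ∂laguerreMeasure =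
      (2 * n + 1) * B n m - (n + 1) * B (n + 1) m - n * B (n - 1) m := fun n m => by
    refine Eq.trans ?_ (integral_mul_sub_mul_sub_mul (hi n m) (hi (n + 1) m) (hi (n - 1) m) _ _ _)
    refine integral_congr_ae (.of_forall fun t => ?_)
    linear_combination (laguerre m).eval t * hX n t
  have hsymm : ∀ n m, B n m = B m n := fun n m => by simp only [hB, mul_comm]
  have hrec : ∀ n m, (n + 1) * B (n + 1) m = (2 * n + 1) * B n m - n * B (n - 1) m -
      ((2 * m + 1) * B n m - (m + 1) * B n (m + 1) - m * B n (m - 1)) := fun n m => by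
    have h1 := hl n m
    have h2 := hl m n
    simp only [mul_comm (Polynomial.eval _ (laguerre m))] at h2
    rw [hsymm m n, hsymm (m + 1) n, hsymm (m - 1) n] at h2
    linarith
  change B n m = _
  induction n using Nat.strong_induction_on generalizing m with
  | _ n ih =>
    rcases n with _ | n
    · simp [hB, laguerre_zero, integral_laguerre, eq_comm]
    have h := hrec n m
    rw [ih n (by omega) m, ih n (by omega) (m + 1), ih n (by omega) (m - 1)] at h
    -- The factors `n` here and `m` in `h1` annihilate the terms where the subtraction is truncated.
    have h0 : (n : ℝ) * B (n - 1) m = if n = m + 1 then (n : ℝ) else 0 := by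
      rcases n with _ | n
      · simp
      · rw [Nat.add_sub_cancel, ih n (by omega) m]; simp
    have h1 : (m : ℝ) * (if n = m - 1 then 1 else 0) = if n + 1 = m then (m : ℝ) else 0 := by
      rcases m with _ | m
      · simp
      · simp
    rw [h0, h1] at h
    have hn : (n + 1 : ℝ) ≠ 0 := by positivity
    refine mul_left_cancel₀ hn (h.trans ?_)
    split_ifs <;> first | omega | (subst_vars; push_cast; ring)

/-! ### Completeness of the Laguerre system -/

/-- Only an exponential weight is asked of `f`, not square integrability, so that the result also
applies to `t f` with `f` merely in `L²`. -/
theorem ae_eq_zero_of_integral_laguerre_mul_eq_zero {μ : Measure ℝ} [SFinite μ] {c : ℝ}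
    (hc : 0 < c) {f : ℝ → ℂ} (hf : AEStronglyMeasurable f μ)
    (hint : Integrable (fun t => (Real.exp (c * |t|) : ℂ) * f t) μ)
    (h : ∀ n, ∫ t, (((laguerre n).eval t : ℝ) : ℂ) * f t ∂μ = 0) : f =ᵐ[μ] 0 := by
  have hpow : ∀ n : ℕ, Integrable (fun t : ℝ => (t : ℂ) ^ n * f t) μ :=
    integrable_pow_mul_of_integrable_exp_mul hc hf hint
  have hpol : ∀ p : Polynomial ℝ, Integrable (fun t => ((p.eval t : ℝ) : ℂ) * f t) μ := fun p => by
    induction p using Polynomial.induction_on' with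
    | add p q hp hq => simpa only [Polynomial.eval_add, Complex.ofReal_add, add_mul] using! hp.add hq
    | monomial n a => simpa [mul_assoc] using (hpow n).const_mul (a : ℂ)
  refine ae_eq_zero_of_moments_eq_zero hc hf hint fun k => ?_
  -- Quantifying over `n` lets the recurrence trade one factor `X` for a change of index; `n = 0`
  -- then gives the moments.
  suffices H : ∀ k n : ℕ,
      ∫ t, (((Polynomial.X ^ k * laguerre n).eval t : ℝ) : ℂ) * f t ∂μ = 0 by
    simpa [laguerre_zero] using H k 0
  intro k
  induction k with
  | zero => simpa using h
  | succ k ih =>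
    intro n
    have e : ∀ t : ℝ, (((Polynomial.X ^ (k + 1) * laguerre n).eval t : ℝ) : ℂ) * f t =
        (2 * n + 1) * ((((Polynomial.X ^ k * laguerre n).eval t : ℝ) : ℂ) * f t) -
        (n + 1) * ((((Polynomial.X ^ k * laguerre (n + 1)).eval t : ℝ) : ℂ) * f t) -
        n * ((((Polynomial.X ^ k * laguerre (n - 1)).eval t : ℝ) : ℂ) * f t) := fun t => by
      rw [pow_succ, mul_assoc, X_mul_laguerre]
      simp only [Polynomial.eval_mul, Polynomial.eval_sub, Polynomial.eval_smul, smul_eq_mul]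
      push_cast
      ring
    simp only [e]
    rw [integral_mul_sub_mul_sub_mul (hpol _) (hpol _) (hpol _), ih, ih, ih]
    simp

theorem memLp_pow_mul_exp_laguerreMeasure (k : ℕ) {c : ℝ} (hc : c < 1 / 2) :
    MemLp (fun t : ℝ => ((t ^ k * Real.exp (c * |t|) : ℝ) : ℂ)) 2 laguerreMeasure := by
  rw [memLp_two_iff_integrable_sq_norm (by fun_prop)]
  refine (integrable_pow_mul_exp_laguerreMeasure (2 * k) (c := 2 * c) (by linarith)).congr ?_
  filter_upwards [ae_laguerreMeasure_pos] with t ht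
  rw [Complex.norm_real, Real.norm_eq_abs, sq_abs, mul_pow, ← Real.exp_nat_mul, abs_of_pos ht]
  push_cast
  ring_nf

/-- Cauchy–Schwarz: `t^k e^{c|t|}` is square integrable against `e^{-t}` for `c < 1/2`, and `1/4` is
one such `c`. -/
theorem integrable_exp_mul_pow_mul (k : ℕ) {f : ℝ → ℂ} (hf : MemLp f 2 laguerreMeasure) :
    Integrable (fun t => (Real.exp (1 / 4 * |t|) : ℂ) * ((t : ℂ) ^ k * f t)) laguerreMeasure := by
  refine ((memLp_pow_mul_exp_laguerreMeasure k (c := 1 / 4) (by norm_num)).integrable_mul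
    hf).congr (.of_forall fun t => ?_)
  simp only [Pi.mul_apply]
  push_cast
  ring

theorem memLp_eval_laguerreMeasure (p : Polynomial ℝ) :
    MemLp (fun t : ℝ => ((p.eval t : ℝ) : ℂ)) 2 laguerreMeasure := by
  induction p using Polynomial.induction_on' with
  | add p q hp hq => simpa only [Polynomial.eval_add, Complex.ofReal_add] using! hp.add hq
  | monomial n a =>
    simpa using (memLp_pow_mul_exp_laguerreMeasure n (c := 0) (by norm_num)).const_mul (a : ℂ)

/-- The Laguerre polynomials as elements of `L²(e^{-t} dt)`. -/
noncomputable def laguerreLp (n : ℕ) : Lp ℂ 2 laguerreMeasure :=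
  (memLp_eval_laguerreMeasure (laguerre n)).toLp _

theorem inner_laguerreLp (n : ℕ) (f : Lp ℂ 2 laguerreMeasure) :
    ⟪laguerreLp n, f⟫_ℂ = ∫ t, (((laguerre n).eval t : ℝ) : ℂ) * f t ∂laguerreMeasure := by
  rw [L2.inner_def]
  refine integral_congr_ae ?_
  filter_upwards [(memLp_eval_laguerreMeasure (laguerre n)).coeFn_toLp] with t ht
  rw [laguerreLp, ht]
  simp [mul_comm]

theorem orthonormal_laguerreLp : Orthonormal ℂ laguerreLp := by
  rw [orthonormal_iff_ite]
  intro n m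
  rw [inner_laguerreLp]
  have : ∫ t, (((laguerre n).eval t : ℝ) : ℂ) * laguerreLp m t ∂laguerreMeasure =
      ∫ t, (((laguerre n).eval t * (laguerre m).eval t : ℝ) : ℂ) ∂laguerreMeasure := by
    refine integral_congr_ae ?_
    filter_upwards [(memLp_eval_laguerreMeasure (laguerre m)).coeFn_toLp] with t ht
    rw [laguerreLp, ht]
    push_cast
    rfl
  rw [this, integral_complex_ofReal, integral_laguerre_mul_laguerre]
  split_ifs <;> simp

/-- The Laguerre polynomials form a Hilbert basis of `L²(e^{-t} dt)`. -/
noncomputable def laguerreBasis : HilbertBasis ℕ ℂ (Lp ℂ 2 laguerreMeasure) :=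
  HilbertBasis.mkOfOrthogonalEqBot orthonormal_laguerreLp (by
    rw [Submodule.eq_bot_iff]
    intro f hf
    rw [Submodule.mem_orthogonal] at hf
    refine Lp.eq_zero_iff_ae_eq_zero.2 (ae_eq_zero_of_integral_laguerre_mul_eq_zero (c := 1 / 4)
      (by norm_num) (Lp.aestronglyMeasurable f)
      (by simpa using integrable_exp_mul_pow_mul 0 (Lp.memLp f)) fun n => ?_)
    rw [← inner_laguerreLp]
    exact hf _ (Submodule.subset_span ⟨n, rfl⟩))

theorem laguerreBasis_repr_apply (f : Lp ℂ 2 laguerreMeasure) (n : ℕ) :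
    laguerreBasis.repr f n = ∫ t, (((laguerre n).eval t : ℝ) : ℂ) * f t ∂laguerreMeasure := by
  rw [HilbertBasis.repr_apply_apply, laguerreBasis, HilbertBasis.coe_mkOfOrthogonalEqBot,
    inner_laguerreLp]

/-! ### Multiplication operators and indicator projections on `L²` -/

/-- Multiplication by an essentially bounded function on `L²`. -/
noncomputable def lpMul {α : Type*} {mα : MeasurableSpace α} (μ : Measure α) {m : α → ℂ}
    (hm : MemLp m ∞ μ) : Lp ℂ 2 μ →L[ℂ] Lp ℂ 2 μ :=
  (ContinuousLinearMap.mul ℂ ℂ).holderL μ ∞ 2 2 (hm.toLp m)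

theorem coeFn_lpMul {α : Type*} {mα : MeasurableSpace α} {μ : Measure α} {m : α → ℂ}
    (hm : MemLp m ∞ μ) (f : Lp ℂ 2 μ) : lpMul μ hm f =ᵐ[μ] fun t => m t * f t := by
  have h := (ContinuousLinearMap.mul ℂ ℂ).coeFn_holder (r := 2) (hm.toLp m) f
  filter_upwards [h, hm.coeFn_toLp] with t h1 h2
  refine Eq.trans h1 ?_
  simp [h2]

theorem memLp_top_indicator_one {α : Type*} {mα : MeasurableSpace α} (μ : Measure α) {B : Set α}
    (hB : MeasurableSet B) : MemLp (B.indicator (1 : α → ℂ)) ∞ μ :=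
  memLp_top_of_bound (measurable_one.indicator hB).aestronglyMeasurable 1 (.of_forall fun t => by
    by_cases h : t ∈ B <;> simp [h])

open Classical in
/-- Multiplication by the indicator function of a measurable set on `L²`. -/
noncomputable def lpIndicator {α : Type*} {mα : MeasurableSpace α} (μ : Measure α) (B : Set α) :
    Lp ℂ 2 μ →L[ℂ] Lp ℂ 2 μ :=
  if hB : MeasurableSet B then lpMul μ (memLp_top_indicator_one μ hB) else 0

section lpIndicator

variable {α : Type*} {mα : MeasurableSpace α} {μ : Measure α} {B C : Set α}

theorem coeFn_lpIndicator (hB : MeasurableSet B) (f : Lp ℂ 2 μ) :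
    lpIndicator μ B f =ᵐ[μ] B.indicator f := by
  rw [lpIndicator, dif_pos hB]
  filter_upwards [coeFn_lpMul (memLp_top_indicator_one μ hB) f] with t ht
  rw [ht]
  by_cases h : t ∈ B <;> simp [h]

theorem enorm_sq_eq_lintegral (f : Lp ℂ 2 μ) : ‖f‖ₑ ^ 2 = ∫⁻ t, ‖f t‖ₑ ^ 2 ∂μ := by
  have h := eLpNorm_nnreal_pow_eq_lintegral (f := f) (μ := μ) (p := 2) two_ne_zero
  rw [Lp.enorm_def]
  simpa using h

theorem enorm_lpIndicator_sq (hB : MeasurableSet B) (f : Lp ℂ 2 μ) :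
    ‖lpIndicator μ B f‖ₑ ^ 2 = (μ.withDensity fun t => ‖f t‖ₑ ^ 2) B := by
  rw [enorm_sq_eq_lintegral, withDensity_apply _ hB, ← lintegral_indicator hB]
  refine lintegral_congr_ae ?_
  filter_upwards [coeFn_lpIndicator hB f] with t ht
  rw [ht]
  by_cases h : t ∈ B <;> simp [h]

theorem isFiniteMeasure_withDensity_enorm_sq (f : Lp ℂ 2 μ) :
    IsFiniteMeasure (μ.withDensity fun t => ‖f t‖ₑ ^ 2) :=
  isFiniteMeasure_withDensity (by rw [← enorm_sq_eq_lintegral]; finiteness)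

theorem lpIndicator_univ : lpIndicator μ Set.univ = 1 := by
  ext1 f
  refine Lp.ext ((coeFn_lpIndicator .univ f).trans ?_)
  simp

theorem lpIndicator_empty (f : Lp ℂ 2 μ) : lpIndicator μ ∅ f = 0 := by
  refine Lp.ext ((coeFn_lpIndicator .empty f).trans ?_)
  rw [Set.indicator_empty]
  exact (Lp.coeFn_zero ℂ 2 μ).symm

theorem lpIndicator_union (hB : MeasurableSet B) (hC : MeasurableSet C) (h : Disjoint B C)
    (f : Lp ℂ 2 μ) : lpIndicator μ (B ∪ C) f = lpIndicator μ B f + lpIndicator μ C f := by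
  refine Lp.ext ((coeFn_lpIndicator (hB.union hC) f).trans ?_)
  filter_upwards [Lp.coeFn_add (lpIndicator μ B f) (lpIndicator μ C f), coeFn_lpIndicator hB f,
    coeFn_lpIndicator hC f] with t h1 h2 h3
  rw [h1, Pi.add_apply, h2, h3, Set.indicator_union_of_disjoint h]

theorem isStarProjection_lpIndicator (hB : MeasurableSet B) :
    IsStarProjection (lpIndicator μ B) := by
  refine ⟨?_, ContinuousLinearMap.isSelfAdjoint_iff_isSymmetric.2 fun f g => ?_⟩
  · ext1 f
    refine Lp.ext ?_
    filter_upwards [coeFn_lpIndicator hB (lpIndicator μ B f), coeFn_lpIndicator hB f] with t h1 h2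
    rw [mul_apply_eq_comp, h1, h2]
    by_cases h : t ∈ B <;> simp [h, h2]
  · simp only [ContinuousLinearMap.coe_coe, L2.inner_def]
    refine integral_congr_ae ?_
    filter_upwards [coeFn_lpIndicator hB f, coeFn_lpIndicator hB g] with t h1 h2
    simp only [h1, h2]
    by_cases h : t ∈ B <;> simp [h]

theorem sum_lpIndicator {B : ℕ → Set α} (hB : ∀ i, MeasurableSet (B i))
    (hd : Pairwise fun i j => Disjoint (B i) (B j)) (s : Finset ℕ) (f : Lp ℂ 2 μ) :
    ∑ i ∈ s, lpIndicator μ (B i) f = lpIndicator μ (⋃ i ∈ s, B i) f := by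
  induction s using Finset.induction_on with
  | empty => simp [lpIndicator_empty]
  | insert a s ha ih =>
    rw [Finset.sum_insert ha, ih, Finset.set_biUnion_insert, lpIndicator_union (hB a)
      (s.measurableSet_biUnion fun i _ => hB i)]
    refine Set.disjoint_iUnion₂_right.2 fun i hi => hd ?_
    rintro rfl
    exact ha hi

/-- The squared distance from a partial sum to the limit is the mass that the finite measure `|f|²
dμ` gives to the remaining sets, a tail of a convergent series. -/
theorem hasSum_lpIndicator {B : ℕ → Set α} (hB : ∀ i, MeasurableSet (B i))
    (hd : Pairwise fun i j => Disjoint (B i) (B j)) (f : Lp ℂ 2 μ) :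
    HasSum (fun i => lpIndicator μ (B i) f) (lpIndicator μ (⋃ i, B i) f) := by
  set ν := μ.withDensity fun t => ‖f t‖ₑ ^ 2 with hν
  have := isFiniteMeasure_withDensity_enorm_sq f
  have key : ∀ s : Finset ℕ, edist (∑ i ∈ s, lpIndicator μ (B i) f)
      (lpIndicator μ (⋃ i, B i) f) ^ 2 = ∑' i : {i // i ∉ s}, ν (B i) := fun s => by
    have hm : MeasurableSet (⋃ i ∈ {i | i ∉ s}, B i) :=
      .biUnion (Set.to_countable _) fun i _ => hB i
    have hu : (⋃ i, B i) = (⋃ i ∈ s, B i) ∪ ⋃ i ∈ {i | i ∉ s}, B i := by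
      ext t
      simp only [Set.mem_union, Set.mem_iUnion, Set.mem_ofPred_eq, exists_prop, ← exists_or,
        ← or_and_right, em, true_and]
    rw [sum_lpIndicator hB hd, hu, lpIndicator_union (s.measurableSet_biUnion fun i _ => hB i) hm,
      edist_comm, edist_eq_enorm_sub, add_sub_cancel_left, enorm_lpIndicator_sq hm,
      measure_biUnion (Set.to_countable _) (fun i _ j _ hij => hd hij) fun i _ => hB i]
    · rfl
    · refine Set.disjoint_iUnion₂_left.2 fun i hi => Set.disjoint_iUnion₂_right.2 fun j hj => hd ?_
      rintro rfl
      exact hj hi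
  have h0 := ENNReal.tendsto_tsum_compl_atTop_zero (f := fun i => ν (B i)) (by
    rw [← measure_iUnion hd hB]; finiteness)
  rw [HasSum, tendsto_iff_edist_tendsto_0]
  have h1 := ((ENNReal.continuous_rpow_const (y := 1 / 2)).tendsto 0).comp h0
  rw [ENNReal.zero_rpow_of_pos (by norm_num)] at h1
  refine h1.congr fun s => ?_
  rw [Function.comp_apply, ← key s, ← ENNReal.rpow_natCast, ← ENNReal.rpow_mul]
  norm_num

end lpIndicator

/-! ### Operators unitarily equivalent to multiplication by the variable -/

namespace UnboundedOperator

variable {H : Type*} [NormedAddCommGroup H] [InnerProductSpace ℂ H]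

/-- The unitary `U` turns `A` into multiplication by the variable on `L²(μ)`. -/
structure IsMultiplicationModel {μ : Measure ℝ} (A : H →ₗ.[ℂ] H) (U : H ≃ₗᵢ[ℂ] Lp ℂ 2 μ) :
    Prop where
  mem_domain_iff : ∀ x, x ∈ A.domain ↔ MemLp (fun t : ℝ => (t : ℂ) * U x t) 2 μ
  apply_ae_eq : ∀ x : A.domain, U (A x) =ᵐ[μ] fun t : ℝ => (t : ℂ) * U x t

namespace IsMultiplicationModel

variable {μ : Measure ℝ} {A : H →ₗ.[ℂ] H} {U : H ≃ₗᵢ[ℂ] Lp ℂ 2 μ}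

theorem apply_sub_smul_ae_eq (h : IsMultiplicationModel A U) (z : ℂ) (x : A.domain) :
    U (A x - z • (x : H)) =ᵐ[μ] fun t : ℝ => ((t : ℂ) - z) * U x t := by
  rw [map_sub, map_smul]
  filter_upwards [Lp.coeFn_sub (U (A x)) (z • U x), Lp.coeFn_smul z (U x), h.apply_ae_eq x] with
    t h1 h2 h3
  rw [h1, Pi.sub_apply, h2, h3, Pi.smul_apply, smul_eq_mul, sub_mul]

theorem mem_resolventSet (h : IsMultiplicationModel A U) {z : ℂ} {δ : ℝ} (hδ : 0 < δ)
    (hz : ∀ᵐ t : ℝ ∂μ, δ ≤ ‖(t : ℂ) - z‖) : z ∈ resolventSet A := by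
  have hm : MemLp (fun t : ℝ => ((t : ℂ) - z)⁻¹) ∞ μ :=
    memLp_top_of_bound (by fun_prop) δ⁻¹ (by
      filter_upwards [hz] with t ht
      rw [norm_inv]
      exact inv_anti₀ hδ ht)
  have hne : ∀ᵐ t : ℝ ∂μ, (t : ℂ) - z ≠ 0 := by
    filter_upwards [hz] with t ht
    exact norm_pos_iff.1 (hδ.trans_le ht)
  set R : H →L[ℂ] H := (U.symm : Lp ℂ 2 μ →L[ℂ] H) ∘L lpMul μ hm ∘L (U : H →L[ℂ] Lp ℂ 2 μ) with hR
  have hRU : ∀ y, U (R y) =ᵐ[μ] fun t : ℝ => ((t : ℂ) - z)⁻¹ * U y t := fun y => by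
    have : U (R y) = lpMul μ hm (U y) := by simp [hR]
    rw [this]
    exact coeFn_lpMul hm _
  refine ⟨R, fun y => ?_, fun x => ?_⟩
  · have hd : R y ∈ A.domain := (h.mem_domain_iff _).2 <| by
      -- `t (t - z)⁻¹ g = g + z (t - z)⁻¹ g`, a sum of two `L²` functions.
      refine ((Lp.memLp (U y)).add ((Lp.memLp (U (R y))).const_mul z)).ae_eq ?_
      filter_upwards [hRU y, hne] with t h1 h2
      rw [Pi.add_apply, h1]
      field_simp
      ring
    refine ⟨hd, U.injective (Lp.ext ?_)⟩
    filter_upwards [h.apply_sub_smul_ae_eq z ⟨R y, hd⟩, hRU y, hne] with t h1 h2 h3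
    rw [h1, h2, mul_inv_cancel_left₀ h3]
  · refine U.injective (Lp.ext ?_)
    filter_upwards [hRU (A x - z • (x : H)), h.apply_sub_smul_ae_eq z x, hne] with t h1 h2 h3
    rw [h1, h2, inv_mul_cancel_left₀ h3]

theorem notMem_resolventSet [IsFiniteMeasure μ] (h : IsMultiplicationModel A U) {s : ℝ}
    (hs : ∀ ε > 0, μ (Metric.closedBall s ε) ≠ 0) : (s : ℂ) ∉ resolventSet A := by
  rintro ⟨R, -, hR⟩
  -- The indicator `f` of the `ε`-ball is an approximate eigenvector: a bounded inverse `R` would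
  -- give `‖f‖ ≤ ‖R‖ ε ‖f‖`, and this `ε` makes `‖R‖ ε < 1`.
  set ε : ℝ := (‖R‖ + 1)⁻¹ with hε
  have hε0 : 0 < ε := by positivity
  have hB : MeasurableSet (Metric.closedBall s ε) := Metric.isClosed_closedBall.measurableSet
  set f : Lp ℂ 2 μ := indicatorConstLp 2 hB (measure_ne_top μ _) 1 with hf
  have hfc : f =ᵐ[μ] (Metric.closedBall s ε).indicator fun _ => (1 : ℂ) := indicatorConstLp_coeFn
  have hd : U.symm f ∈ A.domain := (h.mem_domain_iff _).2 <| by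
    rw [U.apply_symm_apply]
    refine (Lp.memLp f).of_le_mul (c := |s| + ε) (by fun_prop) ?_
    filter_upwards [hfc] with t ht
    rw [norm_mul]
    by_cases hmem : t ∈ Metric.closedBall s ε
    · gcongr
      rw [Metric.mem_closedBall, Real.dist_eq] at hmem
      rw [Complex.norm_real, Real.norm_eq_abs]
      have := abs_add_le (t - s) s
      rw [sub_add_cancel] at this
      linarith
    · rw [ht, Set.indicator_of_notMem hmem]; simp
  have h1 : ‖A ⟨U.symm f, hd⟩ - (s : ℂ) • U.symm f‖ ≤ ε * ‖f‖ := by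
    rw [← U.norm_map]
    refine Lp.norm_le_mul_norm_of_ae_le_mul ?_
    filter_upwards [h.apply_sub_smul_ae_eq (s : ℂ) ⟨U.symm f, hd⟩, hfc] with t h1 ht
    rw [h1, U.apply_symm_apply, norm_mul]
    by_cases hmem : t ∈ Metric.closedBall s ε
    · gcongr
      rwa [Metric.mem_closedBall, Real.dist_eq, ← Real.norm_eq_abs, ← Complex.norm_real,
        Complex.ofReal_sub] at hmem
    · rw [ht, Set.indicator_of_notMem hmem]; simp
  have hf0 : 0 < ‖f‖ := by
    rw [norm_pos_iff, hf, ne_eq, ← norm_eq_zero, norm_indicatorConstLp two_ne_zero (by simp)]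
    have : μ.real (Metric.closedBall s ε) ≠ 0 := by
      rw [measureReal_ne_zero_iff]; exact hs ε hε0
    simp only [norm_one, one_mul]
    exact (Real.rpow_pos_of_pos (lt_of_le_of_ne measureReal_nonneg this.symm) _).ne'
  have h2 := R.le_opNorm (A ⟨U.symm f, hd⟩ - (s : ℂ) • U.symm f)
  have h3 := hR ⟨U.symm f, hd⟩
  simp only at h3
  rw [h3, U.symm.norm_map] at h2
  have h4 : ‖f‖ ≤ ‖R‖ * (ε * ‖f‖) := h2.trans (by gcongr)
  have h5 : ‖R‖ * ε < 1 := by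
    rw [hε, ← div_eq_mul_inv, div_lt_one (by positivity)]; linarith
  nlinarith

theorem isFormalAdjoint (h : IsMultiplicationModel A U) : A.IsFormalAdjoint A := fun x y => by
  rw [← U.inner_map_map, ← U.inner_map_map (x : H), L2.inner_def, L2.inner_def]
  refine integral_congr_ae ?_
  filter_upwards [h.apply_ae_eq x, h.apply_ae_eq y] with t h1 h2
  simp only [h1, h2, RCLike.inner_apply, map_mul, Complex.conj_ofReal]
  ring

theorem mem_resolventSet_of_im_ne_zero (h : IsMultiplicationModel A U) {z : ℂ} (hz : z.im ≠ 0) :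
    z ∈ resolventSet A :=
  h.mem_resolventSet (abs_pos.2 hz) (.of_forall fun t => by
    simpa using Complex.abs_im_le_norm ((t : ℂ) - z))

/-- The basic criterion: a symmetric operator with `A - i` and `A + i` both onto is densely defined
and equal to its adjoint. -/
theorem isSelfAdjoint [CompleteSpace H] (h : IsMultiplicationModel A U) : IsSelfAdjoint A := by
  obtain ⟨R, hR, -⟩ := h.mem_resolventSet_of_im_ne_zero (z := Complex.I) (by simp)
  obtain ⟨S, hS, -⟩ := h.mem_resolventSet_of_im_ne_zero (z := -Complex.I) (by simp)
  have hsym := h.isFormalAdjoint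
  have hdense : Dense (A.domain : Set H) := by
    rw [Submodule.dense_iff_topologicalClosure_eq_top, Submodule.topologicalClosure_eq_top_iff,
      Submodule.eq_bot_iff]
    intro y hy
    rw [Submodule.mem_orthogonal] at hy
    obtain ⟨hRd, hRe⟩ := hR y
    -- As `⟪Ry, A Ry⟫` is real, the imaginary part of this identity is `-‖Ry‖² = 0`.
    have h1 : ⟪R y, A ⟨R y, hRd⟩ - Complex.I • R y⟫_ℂ = 0 := by
      rw [hRe]
      exact hy _ hRd
    rw [inner_sub_right, inner_smul_right] at h1
    have h2 := hsym ⟨R y, hRd⟩ ⟨R y, hRd⟩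
    have h3 : (⟪R y, A ⟨R y, hRd⟩⟫_ℂ).im = 0 := by
      rw [← Complex.conj_eq_iff_im, inner_conj_symm]
      exact h2
    have h4 := congrArg Complex.im h1
    simp only [Complex.sub_im, h3, Complex.mul_im, Complex.I_re, Complex.I_im, Complex.zero_im]
      at h4
    have h5 : R y = 0 := by
      have h6 := inner_self_eq_norm_sq (𝕜 := ℂ) (R y)
      rw [RCLike.re_to_complex] at h6
      rw [← norm_eq_zero, ← sq_eq_zero_iff]
      linarith
    rw [← hRe]
    have h6 : (⟨R y, hRd⟩ : A.domain) = 0 := Subtype.ext h5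
    rw [h6, h5]
    simp
  rw [LinearPMap.isSelfAdjoint_def]
  refine (LinearPMap.eq_of_le_of_domain_eq (LinearPMap.IsFormalAdjoint.le_adjoint hdense hsym)
    (le_antisymm (LinearPMap.IsFormalAdjoint.le_adjoint hdense hsym).1 fun y hy => ?_)).symm
  set w := A.adjoint ⟨y, hy⟩ with hw
  have hadj : ∀ x : A.domain, ⟪w, (x : H)⟫_ℂ = ⟪y, A x⟫_ℂ := fun x =>
    LinearPMap.adjoint_isFormalAdjoint hdense ⟨y, hy⟩ x
  -- Here `(A - i) v = (A* - i) y`, so `y - v` is orthogonal to the range of `A + i`. Writing `y - v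
  -- = (A + i) u` forces `y = v`, which lies in the domain.
  obtain ⟨hvd, hve⟩ := hR (w - Complex.I • y)
  obtain ⟨hud, hue⟩ := hS (y - R (w - Complex.I • y))
  set v := R (w - Complex.I • y) with hv
  set u := S (y - v) with hu
  have h1 : ⟪w - Complex.I • y, u⟫_ℂ = ⟪y, A ⟨u, hud⟩ - (-Complex.I) • u⟫_ℂ := by
    rw [inner_sub_left, inner_sub_right, inner_smul_left, inner_smul_right, hadj ⟨u, hud⟩]
    simp
  have h2 : ⟪A ⟨v, hvd⟩ - Complex.I • v, u⟫_ℂ = ⟪v, A ⟨u, hud⟩ - (-Complex.I) • u⟫_ℂ := by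
    rw [inner_sub_left, inner_sub_right, inner_smul_left, inner_smul_right,
      hsym ⟨v, hvd⟩ ⟨u, hud⟩]
    simp
  rw [hve, hue] at h2
  rw [hue] at h1
  have h3 : ⟪y - v, y - v⟫_ℂ = 0 := by
    rw [inner_sub_left, ← h1, ← h2, sub_self]
  rw [sub_eq_zero.1 (inner_self_eq_zero.1 h3)]
  exact hvd

section SpectralMeasure

variable [CompleteSpace H]

/-- The projection-valued measure `B ↦ U⁻¹ 1_B U`. -/
noncomputable def _root_.UnboundedOperator.ProjectionValuedMeasure.ofUnitary
    (U : H ≃ₗᵢ[ℂ] Lp ℂ 2 μ) : ProjectionValuedMeasure H where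
  proj B := (U.symm : Lp ℂ 2 μ →L[ℂ] H) ∘L lpIndicator μ B ∘L (U : H →L[ℂ] Lp ℂ 2 μ)
  isStarProjection B hB := by
    have hP := isStarProjection_lpIndicator (μ := μ) hB
    refine ⟨?_, ContinuousLinearMap.isSelfAdjoint_iff_isSymmetric.2 fun x y => ?_⟩
    · ext1 x
      have := congrArg (fun T : Lp ℂ 2 μ →L[ℂ] Lp ℂ 2 μ => U.symm (T (U x)))
        hP.isIdempotentElem.eq
      simpa using this
    · have := ContinuousLinearMap.isSelfAdjoint_iff_isSymmetric.1 hP.isSelfAdjoint (U x) (U y)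
      simp only [ContinuousLinearMap.coe_coe] at this
      rw [← U.inner_map_map, ← U.inner_map_map x]
      simpa using this
  proj_univ := by
    ext1 x
    simp [lpIndicator_univ]
  hasSum_iUnion B hB hd x :=
    (hasSum_lpIndicator hB hd (U x)).mapL (U.symm : Lp ℂ 2 μ →L[ℂ] H)

theorem _root_.UnboundedOperator.ProjectionValuedMeasure.scalarMeasure_ofUnitary
    (U : H ≃ₗᵢ[ℂ] Lp ℂ 2 μ) (x : H) :
    (ProjectionValuedMeasure.ofUnitary U).scalarMeasure x =
      μ.withDensity fun t => ‖U x t‖ₑ ^ 2 := by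
  ext B hB
  rw [ProjectionValuedMeasure.scalarMeasure_apply _ _ hB, ← enorm_lpIndicator_sq hB]
  have : ‖(ProjectionValuedMeasure.ofUnitary U).proj B x‖ = ‖lpIndicator μ B (U x)‖ :=
    U.symm.norm_map _
  rw [this, ENNReal.ofReal_pow (norm_nonneg _), ofReal_norm]

theorem isSpectralMeasureOf (h : IsMultiplicationModel A U) :
    (ProjectionValuedMeasure.ofUnitary U).IsSpectralMeasureOf A := by
  have hmeas : ∀ x, AEMeasurable (fun t => ‖U x t‖ₑ ^ 2) μ := fun x => by fun_prop
  refine ⟨fun x => ?_, fun x => ?_⟩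
  · rw [h.mem_domain_iff, ProjectionValuedMeasure.scalarMeasure_ofUnitary,
      lintegral_withDensity_eq_lintegral_mul₀ (hmeas x) (by fun_prop)]
    have h1 : AEStronglyMeasurable (fun t : ℝ => (t : ℂ) * U x t) μ := by fun_prop
    have h2 := eLpNorm_nnreal_pow_eq_lintegral (f := fun t : ℝ => (t : ℂ) * U x t) (μ := μ)
      (p := 2) two_ne_zero
    have h3 : ∫⁻ t, ((fun t => ‖U x t‖ₑ ^ 2) * fun t => ENNReal.ofReal (t ^ 2)) t ∂μ =
        eLpNorm (fun t : ℝ => (t : ℂ) * U x t) 2 μ ^ 2 := by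
      simp only [NNReal.coe_ofNat, ENNReal.coe_ofNat, ENNReal.rpow_ofNat] at h2
      rw [h2]
      refine lintegral_congr fun t => ?_
      rw [Pi.mul_apply, enorm_mul, mul_pow, mul_comm, ← sq_abs, ENNReal.ofReal_pow (abs_nonneg _),
        ← Real.norm_eq_abs, ← Complex.norm_real, ofReal_norm]
    rw [h3, ENNReal.pow_lt_top_iff]
    simp [MemLp, h1]
  · rw [ProjectionValuedMeasure.scalarMeasure_ofUnitary,
      integral_withDensity_eq_integral_toReal_smul₀ (hmeas _) (.of_forall fun t => by finiteness),
      ← integral_complex_ofReal, ← U.inner_map_map, L2.inner_def]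
    refine integral_congr_ae ?_
    filter_upwards [h.apply_ae_eq x] with t ht
    rw [ht, RCLike.inner_apply, mul_assoc, RCLike.mul_conj, ENNReal.toReal_pow, toReal_enorm]
    simp [mul_comm]

theorem hasPurelyAbsolutelyContinuousSpectrum (h : IsMultiplicationModel A U) (hμ : μ ≪ volume) :
    HasPurelyAbsolutelyContinuousSpectrum A :=
  ⟨_, h.isSpectralMeasureOf, fun x => by
    rw [ProjectionValuedMeasure.scalarMeasure_ofUnitary]
    exact (withDensity_absolutelyContinuous _ _).trans hμ⟩

end SpectralMeasure

end IsMultiplicationModel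

end UnboundedOperator

/-! ### The Laguerre transform of the radial Laplacian -/

/-- The recurrence integrated against `f`. It needs no assumption that `t f` is in `L²`, which is
what makes it suited to the maximal domain. -/
theorem radialLaplacianExpr_laguerreBasis_repr (f : Lp ℂ 2 laguerreMeasure) (n : ℕ) :
    radialLaplacianExpr (fun k => laguerreBasis.repr f k) n =
      ∫ t : ℝ, (((laguerre n).eval t : ℝ) : ℂ) * ((t : ℂ) * f t) ∂laguerreMeasure := by
  have hi : ∀ k, Integrable (fun t => (((laguerre k).eval t : ℝ) : ℂ) * f t) laguerreMeasure :=
    fun k => (memLp_eval_laguerreMeasure (laguerre k)).integrable_mul (Lp.memLp f)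
  have h := integral_mul_sub_mul_sub_mul (hi n) (hi (n + 1)) (hi (n - 1)) (2 * n + 1) (n + 1) n
  simp only [← laguerreBasis_repr_apply] at h
  refine Eq.trans ?_ (h.symm.trans (integral_congr_ae (.of_forall fun t => ?_)))
  · change -((n : ℂ) + 1) * (_ - _) + (n : ℂ) * (_ - _) = _
    ring
  · have := congrArg (fun p : Polynomial ℝ => ((p.eval t : ℝ) : ℂ)) (X_mul_laguerre n)
    simp only [Polynomial.eval_mul, Polynomial.eval_X, Polynomial.eval_sub, Polynomial.eval_smul,
      smul_eq_mul] at this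
    push_cast at this
    linear_combination -(f t) * this

/-- Both sides have the same Laguerre coefficients, but `t f` is not known to be in `L²` beforehand,
so the Hilbert basis alone does not decide; the exponentially weighted uniqueness does. -/
theorem ae_eq_mul_of_laguerreBasis_repr_eq {f g : Lp ℂ 2 laguerreMeasure}
    (h : ∀ n, laguerreBasis.repr g n = radialLaplacianExpr (fun k => laguerreBasis.repr f k) n) :
    g =ᵐ[laguerreMeasure] fun t : ℝ => (t : ℂ) * f t := by
  have hf := integrable_exp_mul_pow_mul 1 (Lp.memLp f)
  have hg := integrable_exp_mul_pow_mul 0 (Lp.memLp g)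
  simp only [pow_one, pow_zero, one_mul] at hf hg
  have hL : ∀ n, Integrable (fun t : ℝ => (((laguerre n).eval t : ℝ) : ℂ) * ((t : ℂ) * f t))
      laguerreMeasure := fun n => by
    refine ((memLp_eval_laguerreMeasure (laguerre n * Polynomial.X)).integrable_mul
      (Lp.memLp f)).congr (.of_forall fun t => ?_)
    simp [mul_assoc]
  have h0 := ae_eq_zero_of_integral_laguerre_mul_eq_zero (μ := laguerreMeasure) (c := 1 / 4)
    (f := fun t : ℝ => g t - (t : ℂ) * f t) (by norm_num) (by fun_prop)
    (by simpa only [mul_sub] using! hg.sub hf) fun n => by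
      simp only [mul_sub]
      refine (integral_sub ((memLp_eval_laguerreMeasure (laguerre n)).integrable_mul (Lp.memLp g))
        (hL n)).trans ?_
      rw [← radialLaplacianExpr_laguerreBasis_repr, ← h, laguerreBasis_repr_apply]
      exact sub_self _
  filter_upwards [h0] with t ht
  exact sub_eq_zero.1 ht

/-- The Laguerre transform turns the radial Laplacian into multiplication by the variable. -/
theorem isMultiplicationModel_radialLaplacian :
    UnboundedOperator.IsMultiplicationModel radialLaplacian laguerreBasis.repr.symm := by
  have key : ∀ x : radialLaplacian.domain, laguerreBasis.repr.symm (radialLaplacian x)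
      =ᵐ[laguerreMeasure] fun t : ℝ => (t : ℂ) * laguerreBasis.repr.symm (x : SquareSummable) t :=
    fun x => ae_eq_mul_of_laguerreBasis_repr_eq fun n => by
      simp only [LinearIsometryEquiv.apply_symm_apply]
      rfl
  refine ⟨fun x => ⟨fun hx => (Lp.memLp _).ae_eq (key ⟨x, hx⟩), fun hx => ?_⟩, key⟩
  -- If `t f ∈ L²`, then its coefficient sequence is the difference expression of `x`, which is
  -- therefore square summable.
  have e : radialLaplacianExpr (fun n => x n) = laguerreBasis.repr (hx.toLp _) := by
    funext n
    have h := radialLaplacianExpr_laguerreBasis_repr (laguerreBasis.repr.symm x) n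
    rw [LinearIsometryEquiv.apply_symm_apply] at h
    rw [h, laguerreBasis_repr_apply]
    refine integral_congr_ae ?_
    filter_upwards [hx.coeFn_toLp] with t ht
    rw [ht]
  change Memℓp (radialLaplacianExpr fun n => x n) 2
  rw [e]
  exact lp.memℓp _

theorem spectrum_radialLaplacian :
    UnboundedOperator.spectrum radialLaplacian = Complex.ofReal '' Set.Ici (0 : ℝ) := by
  have hclosed : IsClosed (Complex.ofReal '' Set.Ici (0 : ℝ)) :=
    Complex.isometry_ofReal.isClosedEmbedding.isClosedMap _ isClosed_Ici
  ext z
  refine ⟨fun hz => by_contra fun hn => hz ?_, ?_⟩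
  · refine isMultiplicationModel_radialLaplacian.mem_resolventSet
      ((hclosed.notMem_iff_infDist_pos ⟨0, 0, by simp⟩).1 hn) ?_
    filter_upwards [ae_laguerreMeasure_pos] with t ht
    rw [← dist_eq_norm, dist_comm]
    exact Metric.infDist_le_dist_of_mem ⟨t, ht.le, rfl⟩
  · rintro ⟨s, hs, rfl⟩
    refine isMultiplicationModel_radialLaplacian.notMem_resolventSet fun ε hε h0 => ?_
    have hs0 : 0 ≤ s := hs
    -- The right half of the ball stays inside `(0, ∞)` even when `s = 0`.
    refine laguerreMeasure_pos (s := Set.Ioc s (s + ε)) measurableSet_Ioc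
      (fun t ht => hs0.trans_lt ht.1) (by simpa using hε) (measure_mono_null ?_ h0)
    rw [Real.closedBall_eq_Icc]
    exact fun t ht => ⟨by linarith [ht.1], ht.2⟩

theorem mainTheorem1 :
    IsSelfAdjoint radialLaplacian ∧
    UnboundedOperator.spectrum radialLaplacian = Complex.ofReal '' Set.Ici (0 : ℝ) ∧
    UnboundedOperator.HasPurelyAbsolutelyContinuousSpectrum radialLaplacian :=
  ⟨isMultiplicationModel_radialLaplacian.isSelfAdjoint, spectrum_radialLaplacian,
    isMultiplicationModel_radialLaplacian.hasPurelyAbsolutelyContinuousSpectrum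
      laguerreMeasure_absolutelyContinuous⟩
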